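/- Consider a plant $x_{k+1}=Ax_k+Bu_k+w_k$, $y_k=Cx_k+v_k$ ($k\ge 1$, $x_k\in\mathbb R^{N_x}$, $u_k\in\mathbb R^{N_u}$, $y_k\in\mathbb R^{N_y}$), where the $w_k\sim\mathcal N(0,\Sigma_w)$ are i.i.d., the $v_k\sim\mathcal N(0,\Sigma_v)$ are i.i.d., $\Sigma_w,\Sigma_v$ are positive definite, and $x_1\sim\mathcal N(0,P)$; the initial state, the process noise and the measurement noise are mutually independent. Here $P$ is a positive semidefinite solution of the algebraic Riccati equation $P=APA^T-APC^T\Sigma_z^{-1}CPA^T+\Sigma_w$ with $\Sigma_z=CPC^T+\Sigma_v$. Let $K=APC^T\Sigma_z^{-1}$ and $W=C^T\Sigma_z^{-1}C$. The controller uses an arbitrary measurable causal control law $u_k=\mu_k(y_1,\dots,y_k)$ and the Kalman filter $\hat x_{k+1}=A\hat x_k+K(y_k-C\hat x_k)+Bu_k$, $\hat x_1=0$. An attacker replaces the inputs by a sequence $\tilde u_1,\tilde u_2,\dots$, so that $\tilde x_{k+1}=A\tilde x_k+B\tilde u_k+w_k$, $\tilde x_1=x_1$, $\tilde y_k=C\tilde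 x_k+v_k$; the controller, unaware of the attack, computes $u_k=\mu_k(\tilde y_1,\dots,\tilde y_k)$ and $\hat{\tilde x}_{k+1}=A\hat{\tilde x}_k+K(\tilde y_k-C\hat{\tilde x}_k)+Bu_k$, $\hat{\tilde x}_1=0$. The attack is generated by an information pattern: there are increasing $\sigma$-algebras $\mathcal I_k$ (which may include private randomness of the attacker) such that $\tilde u_k$ and $u_k$ are $\mathcal I_k$-measurable and $\mathcal I_k$ is independent of $(w_j)_{j\ge k}$ and independent of $(v_j)_{j\ge k+1}$. Suppose that the attack is strictly stealthy: for no (possibly randomized) detector, which decides at each time $k$ from the first $k$ measurements received, and for no $k>0$ is the probability of false alarm $p^F_k$ (deciding "attack" when it receives $y_1,\dots,y_k$ of the attack-free closed loop) smaller than the probability of correct detection $p^D_k$ (deciding "attack" when it receives $\tilde y_1,\dots,\tilde y_k$). Then the attack induces no performance degradation: with $\tilde e_n=\hat{\tilde x}_n-\tilde x_n$, $$\tilde P_W:=\limsup_{k\to\infty}\frac1k\sum_{n=1}^k \mathbb E\big[\tilde e_n^T W\tilde e_n\big]\le \operatorname{tr}(PW),$$ where $\operatorname{tr}(PW)$ is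 the value of the same performance index in the attack-free closed loop. In particular, if all $\tilde e_n$ are square integrable, so that the covariances $\tilde P_n=\mathbb E[\tilde e_n\tilde e_n^T]$ exist, then $\limsup_{k\to\infty}\frac1k\sum_{n=1}^k\operatorname{tr}(\tilde P_nW)\le\operatorname{tr}(PW)$. -/

import Mathlib

open Matrix MeasureTheory ProbabilityTheory Filter
open scoped ENNReal

namespace StealthyAttack

/-- A linear time-invariant plant `x⁺ = A x + B u + w`, `y = C x + v`, together with the
positive definite covariance matrices of the process noise `w` and the measurement noise `v`. -/
structure Plant (Nx Nu Ny : ℕ) where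
  A : Matrix (Fin Nx) (Fin Nx) ℝ
  B : Matrix (Fin Nx) (Fin Nu) ℝ
  C : Matrix (Fin Ny) (Fin Nx) ℝ
  Sw : Matrix (Fin Nx) (Fin Nx) ℝ
  Sv : Matrix (Fin Ny) (Fin Ny) ℝ
  Sw_posDef : Sw.PosDef
  Sv_posDef : Sv.PosDef

namespace Plant

variable {Nx Nu Ny : ℕ}

/-- Innovation covariance `Σ_z = C P Cᵀ + Σ_v`. -/
noncomputable def innovCov (s : Plant Nx Nu Ny) (P : Matrix (Fin Nx) (Fin Nx) ℝ) :
    Matrix (Fin Ny) (Fin Ny) ℝ :=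
  s.C * P * s.Cᵀ + s.Sv

/-- Steady-state Kalman gain `K = A P Cᵀ Σ_z⁻¹`. -/
noncomputable def kalmanGain (s : Plant Nx Nu Ny) (P : Matrix (Fin Nx) (Fin Nx) ℝ) :
    Matrix (Fin Nx) (Fin Ny) ℝ :=
  s.A * P * s.Cᵀ * (s.innovCov P)⁻¹

/-- Weight `W = Cᵀ Σ_z⁻¹ C` of the performance index. -/
noncomputable def weight (s : Plant Nx Nu Ny) (P : Matrix (Fin Nx) (Fin Nx) ℝ) :
    Matrix (Fin Nx) (Fin Nx) ℝ :=
  s.Cᵀ * (s.innovCov P)⁻¹ * s.C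

/-- `P` is a positive semidefinite solution of the filtering algebraic Riccati equation. Since
`Σ_w` and `Σ_v` are positive definite there is at most one such `P`. -/
structure IsRiccatiSolution (s : Plant Nx Nu Ny) (P : Matrix (Fin Nx) (Fin Nx) ℝ) : Prop where
  posSemidef : P.PosSemidef
  eq : P = s.A * P * s.Aᵀ - s.A * P * s.Cᵀ * (s.innovCov P)⁻¹ * s.C * P * s.Aᵀ + s.Sw

/-! ### Dynamics along one realization. Time starts at `0`. -/

/-- State driven by the applied input `u` and the process noise `w`. -/
def state (s : Plant Nx Nu Ny) (x₀ : Fin Nx → ℝ) (w : ℕ → Fin Nx → ℝ) (u : ℕ → Fin Nu → ℝ) :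
    ℕ → Fin Nx → ℝ
  | 0 => x₀
  | k + 1 => s.A *ᵥ s.state x₀ w u k + s.B *ᵥ u k + w k

/-- Measurements produced when the applied input is `u`. -/
def output (s : Plant Nx Nu Ny) (x₀ : Fin Nx → ℝ) (w : ℕ → Fin Nx → ℝ) (v : ℕ → Fin Ny → ℝ)
    (u : ℕ → Fin Nu → ℝ) (k : ℕ) : Fin Ny → ℝ :=
  s.C *ᵥ s.state x₀ w u k + v k

end Plant

/-- An arbitrary (nonlinear, time-varying) causal control law: the input at time `k` is a measurable
function of the measurements received at the times `0, …, k`. -/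
structure ControlLaw (Nu Ny : ℕ) where
  law : (k : ℕ) → (Fin (k + 1) → Fin Ny → ℝ) → Fin Nu → ℝ
  measurable_law : ∀ k, Measurable (law k)

/-- The control inputs that the controller computes from the measurement sequence `y`. -/
def ControlLaw.input {Nu Ny : ℕ} (c : ControlLaw Nu Ny) (y : ℕ → Fin Ny → ℝ) (k : ℕ) :
    Fin Nu → ℝ :=
  c.law k (fun i => y i)

namespace Plant

variable {Nx Nu Ny : ℕ}

/-- The controller's Kalman filter: estimate of the state computed from the received measurements
`y` and from the control inputs that the controller itself computes. -/
noncomputable def estimate (s : Plant Nx Nu Ny) (P : Matrix (Fin Nx) (Fin Nx) ℝ)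
    (c : ControlLaw Nu Ny) (y : ℕ → Fin Ny → ℝ) : ℕ → Fin Nx → ℝ
  | 0 => 0
  | k + 1 => s.A *ᵥ s.estimate P c y k
      + s.kalmanGain P *ᵥ (y k - s.C *ᵥ s.estimate P c y k) + s.B *ᵥ c.input y k

/-- The nominal (attack-free) closed loop: the state at time `k` and the measurements at the times
`0, …, k`. -/
def nominalLoop (s : Plant Nx Nu Ny) (c : ControlLaw Nu Ny) (x₀ : Fin Nx → ℝ)
    (w : ℕ → Fin Nx → ℝ) (v : ℕ → Fin Ny → ℝ) :
    (k : ℕ) → (Fin Nx → ℝ) × (Fin (k + 1) → Fin Ny → ℝ)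
  | 0 => (x₀, fun _ => s.C *ᵥ x₀ + v 0)
  | k + 1 =>
    let r := s.nominalLoop c x₀ w v k
    let x := s.A *ᵥ r.1 + s.B *ᵥ c.law k r.2 + w k
    (x, Fin.snoc (α := fun _ => Fin Ny → ℝ) r.2 (s.C *ᵥ x + v (k + 1)))

/-- The control inputs of the nominal closed loop. -/
def nominalInput (s : Plant Nx Nu Ny) (c : ControlLaw Nu Ny) (x₀ : Fin Nx → ℝ)
    (w : ℕ → Fin Nx → ℝ) (v : ℕ → Fin Ny → ℝ) (k : ℕ) : Fin Nu → ℝ :=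
  c.law k (s.nominalLoop c x₀ w v k).2

theorem nominalLoop_eq (s : Plant Nx Nu Ny) (c : ControlLaw Nu Ny) (x₀ : Fin Nx → ℝ)
    (w : ℕ → Fin Nx → ℝ) (v : ℕ → Fin Ny → ℝ) (k : ℕ) :
    s.nominalLoop c x₀ w v k =
      (s.state x₀ w (s.nominalInput c x₀ w v) k,
        fun i : Fin (k + 1) => s.output x₀ w v (s.nominalInput c x₀ w v) i) := by
  induction k with
  | zero =>
    refine Prod.ext rfl (funext fun i => ?_)
    obtain rfl : i = 0 := Fin.fin_one_eq_zero i
    rfl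
  | succ k ih =>
    have h1 : (s.nominalLoop c x₀ w v (k + 1)).1 =
        s.state x₀ w (s.nominalInput c x₀ w v) (k + 1) := by
      simp only [nominalLoop, state, nominalInput]
      rw [ih]
    refine Prod.ext h1 (funext fun i => ?_)
    refine Fin.lastCases ?_ (fun j => ?_) i
    · have h2 : (s.nominalLoop c x₀ w v (k + 1)).2 (Fin.last _) =
          s.C *ᵥ (s.nominalLoop c x₀ w v (k + 1)).1 + v (k + 1) := by
        simp [nominalLoop]
      rw [h2, h1]
      simp [output]
    · have h2 : (s.nominalLoop c x₀ w v (k + 1)).2 j.castSucc =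
          (s.nominalLoop c x₀ w v k).2 j := by
        simp [nominalLoop]
      rw [h2, ih]
      simp

/-- In the nominal closed loop the applied input is the control law evaluated at the measurements
that this input produces. -/
theorem input_output_nominalInput (s : Plant Nx Nu Ny) (c : ControlLaw Nu Ny) (x₀ : Fin Nx → ℝ)
    (w : ℕ → Fin Nx → ℝ) (v : ℕ → Fin Ny → ℝ) :
    c.input (s.output x₀ w v (s.nominalInput c x₀ w v)) = s.nominalInput c x₀ w v := by
  funext k
  simp only [ControlLaw.input]
  conv_rhs => rw [nominalInput, nominalLoop_eq]

end Plant

/-! ### Stochastic model -/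

/-- Initial state, process noise and measurement noise on a sample space. -/
structure Noise (Ω : Type*) (Nx Ny : ℕ) where
  x₀ : Ω → Fin Nx → ℝ
  w : ℕ → Ω → Fin Nx → ℝ
  v : ℕ → Ω → Fin Ny → ℝ

section

variable {Ω : Type*} {mΩ : MeasurableSpace Ω} {Nx Nu Ny : ℕ}

/-- `x₀ ∼ N(0, P)`, the `w k ∼ N(0, Σ_w)` are i.i.d., the `v k ∼ N(0, Σ_v)` are i.i.d., and the
initial state, the process noise and the measurement noise are mutually independent. -/
structure Noise.IsGaussian (ξ : Noise Ω Nx Ny) (s : Plant Nx Nu Ny)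
    (P : Matrix (Fin Nx) (Fin Nx) ℝ) (μ : Measure Ω) : Prop where
  measurable_x₀ : Measurable ξ.x₀
  measurable_w : ∀ k, Measurable (ξ.w k)
  measurable_v : ∀ k, Measurable (ξ.v k)
  law_x₀ : HasLaw (fun ω => WithLp.toLp 2 (ξ.x₀ ω)) (multivariateGaussian 0 P) μ
  law_w : ∀ k, HasLaw (fun ω => WithLp.toLp 2 (ξ.w k ω)) (multivariateGaussian 0 s.Sw) μ
  law_v : ∀ k, HasLaw (fun ω => WithLp.toLp 2 (ξ.v k ω)) (multivariateGaussian 0 s.Sv) μ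
  indep_w : iIndepFun ξ.w μ
  indep_v : iIndepFun ξ.v μ
  indep_w_v : IndepFun (fun ω k => ξ.w k ω) (fun ω k => ξ.v k ω) μ
  indep_x₀ : IndepFun ξ.x₀ (fun ω => ((fun k => ξ.w k ω), (fun k => ξ.v k ω))) μ

/-- Measurement process when the process `u` is applied to the plant. -/
def outputProc (s : Plant Nx Nu Ny) (ξ : Noise Ω Nx Ny) (u : ℕ → Ω → Fin Nu → ℝ)
    (k : ℕ) (ω : Ω) : Fin Ny → ℝ :=
  s.output (ξ.x₀ ω) (fun j => ξ.w j ω) (fun j => ξ.v j ω) (fun j => u j ω) k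

/-- The input that the controller requests, computed from the measurements it receives while `u` is
applied to the plant. -/
def requestedInput (s : Plant Nx Nu Ny) (c : ControlLaw Nu Ny) (ξ : Noise Ω Nx Ny)
    (u : ℕ → Ω → Fin Nu → ℝ) (k : ℕ) (ω : Ω) : Fin Nu → ℝ :=
  c.input (fun j => outputProc s ξ u j ω) k

/-- Input process of the nominal closed loop. -/
def nominalProc (s : Plant Nx Nu Ny) (c : ControlLaw Nu Ny) (ξ : Noise Ω Nx Ny)
    (k : ℕ) (ω : Ω) : Fin Nu → ℝ :=
  s.nominalInput c (ξ.x₀ ω) (fun j => ξ.w j ω) (fun j => ξ.v j ω) k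

/-- Estimation error `x̂ - x` of the controller's Kalman filter while `u` is applied to the plant. -/
noncomputable def estError (s : Plant Nx Nu Ny) (P : Matrix (Fin Nx) (Fin Nx) ℝ)
    (c : ControlLaw Nu Ny) (ξ : Noise Ω Nx Ny) (u : ℕ → Ω → Fin Nu → ℝ)
    (k : ℕ) (ω : Ω) : Fin Nx → ℝ :=
  s.estimate P c (fun j => outputProc s ξ u j ω) k
    - s.state (ξ.x₀ ω) (fun j => ξ.w j ω) (fun j => u j ω) k

/-- The attack `u` is generated by the information pattern `ℐ` (increasing σ-algebras, which may
contain private randomness of the attacker): the attacker knows the requested control input, and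
`ℐ k` is independent of the process noise from time `k` on and of the measurement noise from time
`k + 1` on. -/
structure IsAttack (s : Plant Nx Nu Ny) (c : ControlLaw Nu Ny) (ξ : Noise Ω Nx Ny) (μ : Measure Ω)
    (ℐ : Filtration ℕ mΩ) (u : ℕ → Ω → Fin Nu → ℝ) : Prop where
  measurable_attack : ∀ k, Measurable[ℐ k] (u k)
  knows_input : ∀ k, Measurable[ℐ k] (requestedInput s c ξ u k)
  indep_w : ∀ k, Indep (ℐ k)
    (MeasurableSpace.comap (fun ω (j : ℕ) => ξ.w (k + j) ω) inferInstance) μ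
  indep_v : ∀ k, Indep (ℐ k)
    (MeasurableSpace.comap (fun ω (j : ℕ) => ξ.v (k + 1 + j) ω) inferInstance) μ

/-- A (possibly randomized) detector: `test k y` is the probability of declaring an attack after
the first `k` measurements `y` have been received. -/
structure Detector (Ny : ℕ) where
  test : (k : ℕ) → (Fin k → Fin Ny → ℝ) → ℝ
  measurable_test : ∀ k, Measurable (test k)
  test_mem : ∀ k y, test k y ∈ Set.Icc (0 : ℝ) 1

/-- Probability that the detector declares an attack after the first `k` measurements of the
process `y`: the false-alarm probability if `y` is the nominal output, the probability of correct
detection if `y` is the output under attack. -/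
noncomputable def Detector.alarmProb (d : Detector Ny) (μ : Measure Ω) (y : ℕ → Ω → Fin Ny → ℝ)
    (k : ℕ) : ℝ :=
  ∫ ω, d.test k (fun i => y i ω) ∂μ

/-- No detector has, at any time `k > 0`, a detection probability larger than its false-alarm
probability. -/
def StrictlyStealthy (s : Plant Nx Nu Ny) (c : ControlLaw Nu Ny) (ξ : Noise Ω Nx Ny)
    (μ : Measure Ω) (u : ℕ → Ω → Fin Nu → ℝ) : Prop :=
  ¬ ∃ (d : Detector Ny) (k : ℕ), 0 < k ∧
    d.alarmProb μ (outputProc s ξ (nominalProc s c ξ)) k < d.alarmProb μ (outputProc s ξ u) k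

/-- `E[eᵀ W e] ∈ [0, ∞]` for a random vector `e` and a positive semidefinite `W`. -/
noncomputable def weightedMSE (μ : Measure Ω) (W : Matrix (Fin Nx) (Fin Nx) ℝ)
    (e : Ω → Fin Nx → ℝ) : ℝ≥0∞ :=
  ∫⁻ ω, ENNReal.ofReal (e ω ⬝ᵥ W *ᵥ e ω) ∂μ

/-- `limsup_k (1/k) ∑_{n<k} E[eₙᵀ W eₙ]`, with values in `[0, ∞]`. -/
noncomputable def avgWeightedMSE (μ : Measure Ω) (W : Matrix (Fin Nx) (Fin Nx) ℝ)
    (e : ℕ → Ω → Fin Nx → ℝ) : ℝ≥0∞ :=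
  limsup (fun k : ℕ => (∑ n ∈ Finset.range k, weightedMSE μ W (e n)) / (k : ℝ≥0∞)) atTop

/-- The matrix `E[e eᵀ]`, meaningful for square integrable `e`. -/
noncomputable def errorCov (μ : Measure Ω) (e : Ω → Fin Nx → ℝ) : Matrix (Fin Nx) (Fin Nx) ℝ :=
  Matrix.of fun i j => ∫ ω, e ω i * e ω j ∂μ

/-- `limsup_k (1/k) ∑_{n<k} tr(E[eₙ eₙᵀ] W)`, taken in the extended reals. -/
noncomputable def avgTraceCov (μ : Measure Ω) (W : Matrix (Fin Nx) (Fin Nx) ℝ)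
    (e : ℕ → Ω → Fin Nx → ℝ) : EReal :=
  limsup (fun k : ℕ =>
    (((∑ n ∈ Finset.range k, (errorCov μ (e n) * W).trace) / (k : ℝ) : ℝ) : EReal)) atTop

end

end StealthyAttack

/-! Indicators of measurable sets are admissible tests, so strict stealth bounds the law of the
received measurements under attack by the nominal law on every event. Two probability measures
ordered in this way coincide (`StrictlyStealthy.identDistrib`). The innovation `z = y - C x̂` is a
fixed measurable function of the received measurements, hence it too has its nominal law and nominal
second moment.

In either loop `z k = v k - C e k`, where `e` is the estimation error. By linearity `e` is the
nominal error plus a response to the difference between requested and applied input (`estError_eq`).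
The nominal error contains only past noise and is uncorrelated with `v k`. The response at time `k`
uses only inputs before `k`, so it is independent of `v k` (`IsAttack.indepFun_errorResponse`).
Comparing second moments of `z k` and cancelling `E[v vᵀ]` gives `E[(C e)(C e)ᵀ] = C P Cᵀ`
(`StrictlyStealthy.outputError`), since `P` is the stationary covariance of the nominal error. The
weight `W = Cᵀ Σ_z⁻¹ C` sees `e` only through `C e`, so `E[eᵀ W e] = tr(P W)` holds with equality at
every time, and averaging is trivial.

Square integrability of `e` is not available in general; it is established only for `C e = v - z`.
-/

namespace StealthyAttack

/-! ### Second moments of random vectors -/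

section Moments

variable {Ω : Type*} {mΩ : MeasurableSpace Ω} {μ : Measure Ω} {a b d : ℕ}

/-- The matrix `E[f gᵀ]`, meaningful for square integrable `f` and `g`. -/
noncomputable def crossMoment (μ : Measure Ω) (f : Ω → Fin a → ℝ) (g : Ω → Fin b → ℝ) :
    Matrix (Fin a) (Fin b) ℝ :=
  Matrix.of fun i j => ∫ ω, f ω i * g ω j ∂μ

theorem integrable_mul_apply {f : Ω → Fin a → ℝ} {g : Ω → Fin b → ℝ} (hf : MemLp f 2 μ)
    (hg : MemLp g 2 μ) (i : Fin a) (j : Fin b) : Integrable (fun ω => f ω i * g ω j) μ :=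
  (hf.eval i).integrable_mul (hg.eval j)

theorem memLp_mulVec (M : Matrix (Fin d) (Fin a) ℝ) {f : Ω → Fin a → ℝ} (hf : MemLp f 2 μ) :
    MemLp (fun ω => M *ᵥ f ω) 2 μ :=
  MemLp.of_eval fun i => by
    simp only [mulVec, dotProduct]
    exact memLp_finsetSum _ fun j _ => (hf.eval j).const_mul _

theorem crossMoment_transpose (f : Ω → Fin a → ℝ) (g : Ω → Fin b → ℝ) :
    (crossMoment μ f g)ᵀ = crossMoment μ g f := by
  ext i j
  simp [crossMoment, mul_comm]

theorem crossMoment_add_left {f f' : Ω → Fin a → ℝ} {g : Ω → Fin b → ℝ} (hf : MemLp f 2 μ)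
    (hf' : MemLp f' 2 μ) (hg : MemLp g 2 μ) :
    crossMoment μ (fun ω => f ω + f' ω) g = crossMoment μ f g + crossMoment μ f' g := by
  ext i j
  simp only [crossMoment, of_apply, Matrix.add_apply, Pi.add_apply, add_mul]
  exact integral_add (integrable_mul_apply hf hg i j) (integrable_mul_apply hf' hg i j)

theorem crossMoment_mulVec_left (M : Matrix (Fin d) (Fin a) ℝ) {f : Ω → Fin a → ℝ}
    {g : Ω → Fin b → ℝ} (hf : MemLp f 2 μ) (hg : MemLp g 2 μ) :
    crossMoment μ (fun ω => M *ᵥ f ω) g = M * crossMoment μ f g := by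
  ext i j
  simp only [crossMoment, of_apply, mul_apply, mulVec, dotProduct, Finset.sum_mul, mul_assoc]
  rw [integral_finsetSum _ fun l _ => (integrable_mul_apply hf hg l j).const_mul _]
  simp only [integral_const_mul]

theorem crossMoment_neg_left (f : Ω → Fin a → ℝ) (g : Ω → Fin b → ℝ) :
    crossMoment μ (fun ω => -f ω) g = -crossMoment μ f g := by
  ext i j
  simp [crossMoment, integral_neg]

theorem crossMoment_neg_right (f : Ω → Fin a → ℝ) (g : Ω → Fin b → ℝ) :
    crossMoment μ f (fun ω => -g ω) = -crossMoment μ f g := by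
  ext i j
  simp [crossMoment, integral_neg]

theorem crossMoment_add_right {f : Ω → Fin a → ℝ} {g g' : Ω → Fin b → ℝ} (hf : MemLp f 2 μ)
    (hg : MemLp g 2 μ) (hg' : MemLp g' 2 μ) :
    crossMoment μ f (fun ω => g ω + g' ω) = crossMoment μ f g + crossMoment μ f g' := by
  rw [← crossMoment_transpose, crossMoment_add_left hg hg' hf, transpose_add,
    crossMoment_transpose, crossMoment_transpose]

theorem crossMoment_mulVec_right (M : Matrix (Fin d) (Fin b) ℝ) {f : Ω → Fin a → ℝ}
    {g : Ω → Fin b → ℝ} (hf : MemLp f 2 μ) (hg : MemLp g 2 μ) :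
    crossMoment μ f (fun ω => M *ᵥ g ω) = crossMoment μ f g * Mᵀ := by
  rw [← crossMoment_transpose, crossMoment_mulVec_left M hg hf, transpose_mul,
    crossMoment_transpose]

/-- The second moment of a sum of uncorrelated vectors. -/
theorem crossMoment_add_self {f g : Ω → Fin a → ℝ} (hf : MemLp f 2 μ) (hg : MemLp g 2 μ)
    (h : crossMoment μ f g = 0) :
    crossMoment μ (fun ω => f ω + g ω) (fun ω => f ω + g ω)
      = crossMoment μ f f + crossMoment μ g g := by
  have h' : crossMoment μ g f = 0 := by rw [← crossMoment_transpose, h, transpose_zero]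
  have hfg : MemLp (fun ω => f ω + g ω) 2 μ := hf.add hg
  rw [crossMoment_add_left hf hg hfg, crossMoment_add_right hf hf hg,
    crossMoment_add_right hg hf hg, h, h', add_zero, zero_add]

theorem crossMoment_mulVec_self (M : Matrix (Fin d) (Fin a) ℝ) {f : Ω → Fin a → ℝ}
    (hf : MemLp f 2 μ) :
    crossMoment μ (fun ω => M *ᵥ f ω) (fun ω => M *ᵥ f ω) = M * crossMoment μ f f * Mᵀ := by
  rw [crossMoment_mulVec_left M hf (memLp_mulVec M hf), crossMoment_mulVec_right M hf hf,
    Matrix.mul_assoc]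

theorem crossMoment_eq_zero_of_indepFun {f : Ω → Fin a → ℝ} {g : Ω → Fin b → ℝ}
    (hf : AEStronglyMeasurable f μ) (hg : AEStronglyMeasurable g μ) (h : IndepFun f g μ)
    (h0 : ∀ i, ∫ ω, f ω i ∂μ = 0) : crossMoment μ f g = 0 := by
  ext i j
  have hi : IndepFun (fun ω => f ω i) (fun ω => g ω j) μ :=
    h.comp (measurable_pi_apply i) (measurable_pi_apply j)
  have := hi.integral_fun_mul_eq_mul_integral
    ((continuous_apply i).comp_aestronglyMeasurable hf)
    ((continuous_apply j).comp_aestronglyMeasurable hg)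
  simp [crossMoment, this, h0]

theorem crossMoment_congr_identDistrib {f g : Ω → Fin a → ℝ} (h : IdentDistrib f g μ μ) :
    crossMoment μ f f = crossMoment μ g g := by
  ext i j
  have hm : Measurable fun x : Fin a → ℝ => x i * x j := by fun_prop
  exact (h.comp hm).integral_eq

theorem integrable_quadraticForm (M : Matrix (Fin a) (Fin a) ℝ) {f : Ω → Fin a → ℝ}
    (hf : MemLp f 2 μ) : Integrable (fun ω => f ω ⬝ᵥ M *ᵥ f ω) μ := by
  simp only [dotProduct]
  exact integrable_finsetSum _ fun i _ => integrable_mul_apply hf (memLp_mulVec M hf) i i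

theorem integral_quadraticForm (M : Matrix (Fin a) (Fin a) ℝ) {f : Ω → Fin a → ℝ}
    (hf : MemLp f 2 μ) :
    ∫ ω, f ω ⬝ᵥ M *ᵥ f ω ∂μ = (crossMoment μ f f * M).trace := by
  have h : (crossMoment μ f f * M).trace = (M * crossMoment μ f f).trace := trace_mul_comm _ _
  rw [h, ← crossMoment_mulVec_left M hf hf]
  simp only [dotProduct, trace, diag, crossMoment, of_apply]
  rw [integral_finsetSum _ fun i _ => integrable_mul_apply hf (memLp_mulVec M hf) i i]
  simp only [mul_comm]

theorem weightedMSE_eq {M : Matrix (Fin a) (Fin a) ℝ} (hM : M.PosSemidef) {f : Ω → Fin a → ℝ}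
    (hf : MemLp f 2 μ) :
    weightedMSE μ M f = ENNReal.ofReal (crossMoment μ f f * M).trace := by
  rw [weightedMSE, ← integral_quadraticForm M hf,
    ofReal_integral_eq_lintegral_ofReal (integrable_quadraticForm M hf)]
  exact ae_of_all _ fun ω => by simpa using hM.dotProduct_mulVec_nonneg (f ω)

/-- The identity is pointwise and needs no moments of `f`. It is applied to an error of which only
the image under `C` is known to be square integrable. -/
theorem weightedMSE_mulVec (C : Matrix (Fin b) (Fin a) ℝ) (M : Matrix (Fin b) (Fin b) ℝ)
    (f : Ω → Fin a → ℝ) :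
    weightedMSE μ (Cᵀ * M * C) f = weightedMSE μ M (fun ω => C *ᵥ f ω) := by
  simp only [weightedMSE, dotProduct_mulVec, ← mulVec_mulVec, vecMul_transpose]

/-! ### Moments of centred Gaussian vectors. -/

section Gaussian

variable {f : Ω → Fin a → ℝ} {S : Matrix (Fin a) (Fin a) ℝ}

theorem memLp_of_hasLaw_multivariateGaussian
    (h : HasLaw (fun ω => WithLp.toLp 2 (f ω)) (multivariateGaussian 0 S) μ) : MemLp f 2 μ := by
  have h1 : MemLp (fun ω => WithLp.toLp 2 (f ω)) 2 μ := by
    have := IsGaussian.memLp_two_id (μ := multivariateGaussian 0 S)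
    rw [← h.map_eq] at this
    exact (memLp_map_measure_iff aestronglyMeasurable_id h.aemeasurable).1 this
  exact MemLp.of_eval fun i => h1.eval_piLp i

theorem integral_eq_zero_of_hasLaw_multivariateGaussian
    (h : HasLaw (fun ω => WithLp.toLp 2 (f ω)) (multivariateGaussian 0 S) μ) (i : Fin a) :
    ∫ ω, f ω i ∂μ = 0 := by
  have h1 : ∫ ω, f ω i ∂μ = ∫ x, x i ∂(multivariateGaussian 0 S) := by
    rw [← h.map_eq, integral_map h.aemeasurable (by fun_prop)]
  have h2 := (EuclideanSpace.proj (𝕜 := ℝ) i).integral_comp_comm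
    (IsGaussian.integrable_id (μ := multivariateGaussian (0 : EuclideanSpace ℝ (Fin a)) S))
  simp only [id, integral_id_multivariateGaussian, map_zero] at h2
  rw [h1]
  exact h2

theorem crossMoment_of_hasLaw_multivariateGaussian (hS : S.PosSemidef)
    (h : HasLaw (fun ω => WithLp.toLp 2 (f ω)) (multivariateGaussian 0 S) μ) :
    crossMoment μ f f = S := by
  ext i j
  have h0 (l : Fin a) : ∫ x, x l ∂(multivariateGaussian 0 S) = 0 := by
    rw [← integral_eq_zero_of_hasLaw_multivariateGaussian h l, ← h.map_eq,
      integral_map h.aemeasurable (by fun_prop)]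
  rw [← covariance_eval_multivariateGaussian (μ := 0) hS i j, covariance, h0, h0, ← h.map_eq,
    integral_map h.aemeasurable (by fun_prop)]
  simp [crossMoment]

end Gaussian

end Moments

/-! ### Dynamics of the estimation error -/

namespace Plant

variable {Nx Nu Ny : ℕ} (s : Plant Nx Nu Ny) (P : Matrix (Fin Nx) (Fin Nx) ℝ)

/-- The linear recursion `e⁺ = (A - K C) e + d` of the filtering error. -/
noncomputable def errorResponse (e₀ : Fin Nx → ℝ) (d : ℕ → Fin Nx → ℝ) : ℕ → Fin Nx → ℝ
  | 0 => e₀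
  | k + 1 => (s.A - s.kalmanGain P * s.C) *ᵥ errorResponse e₀ d k + d k

@[simp] theorem errorResponse_zero (k : ℕ) : s.errorResponse P 0 (fun _ => 0) k = 0 := by
  induction k with
  | zero => rfl
  | succ k ih => simp [errorResponse, ih]

/-- The error splits into the response to the noise and the response to the difference between the
requested and the applied input. -/
theorem estimate_sub_state (c : ControlLaw Nu Ny) (x₀ : Fin Nx → ℝ) (w : ℕ → Fin Nx → ℝ)
    (v : ℕ → Fin Ny → ℝ) (u : ℕ → Fin Nu → ℝ) (k : ℕ) :
    s.estimate P c (s.output x₀ w v u) k - s.state x₀ w u k =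
      s.errorResponse P 0 (fun j => s.B *ᵥ (c.input (s.output x₀ w v u) j - u j)) k +
        s.errorResponse P (-x₀) (fun j => s.kalmanGain P *ᵥ v j - w j) k := by
  induction k with
  | zero => simp [estimate, state, errorResponse]
  | succ k ih =>
    -- Stated for arbitrary `e` and `n` so that, after rewriting, the sum `e + n` is the right-hand
    -- side of the induction hypothesis.
    have h : ∀ e n : Fin Nx → ℝ, (s.A - s.kalmanGain P * s.C) *ᵥ e +
        s.B *ᵥ (c.input (s.output x₀ w v u) k - u k) +
        ((s.A - s.kalmanGain P * s.C) *ᵥ n + (s.kalmanGain P *ᵥ v k - w k)) =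
        (s.A - s.kalmanGain P * s.C) *ᵥ (e + n) +
        s.B *ᵥ (c.input (s.output x₀ w v u) k - u k) + (s.kalmanGain P *ᵥ v k - w k) := by
      intro e n
      rw [mulVec_add]
      abel
    simp only [errorResponse]
    rw [h, ← ih]
    simp only [estimate, state, output, sub_mulVec, mulVec_sub, mulVec_add, ← mulVec_mulVec]
    abel

/-- The innovation `y - C x̂` of the controller's Kalman filter. -/
noncomputable def innovation (c : ControlLaw Nu Ny) (y : ℕ → Fin Ny → ℝ) (k : ℕ) : Fin Ny → ℝ :=
  y k - s.C *ᵥ s.estimate P c y k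

/-- The filter is a one-step predictor: `y k` and the input computed from it first enter the
estimate at time `k + 1`. -/
theorem estimate_congr (c : ControlLaw Nu Ny) {y y' : ℕ → Fin Ny → ℝ} {k : ℕ}
    (h : ∀ j < k, y j = y' j) : s.estimate P c y k = s.estimate P c y' k := by
  induction k with
  | zero => rfl
  | succ k ih =>
    have h1 : c.input y k = c.input y' k :=
      congrArg (c.law k) (funext fun i : Fin (k + 1) => h i i.2)
    simp only [estimate, ih fun j hj => h j (hj.trans (Nat.lt_succ_self k)),
      h k (Nat.lt_succ_self k), h1]

/-! ### Measurability of the closed-loop signals. -/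

theorem measurable_mulVec {α : Type*} [MeasurableSpace α] {a b : ℕ} (M : Matrix (Fin a) (Fin b) ℝ)
    {f : α → Fin b → ℝ} (hf : Measurable f) : Measurable fun x => M *ᵥ f x :=
  (Continuous.matrix_mulVec continuous_const continuous_id).measurable.comp hf

theorem measurable_input {α : Type*} [MeasurableSpace α] (c : ControlLaw Nu Ny)
    {y : α → ℕ → Fin Ny → ℝ} (hy : ∀ j, Measurable fun x => y x j) (k : ℕ) :
    Measurable fun x => c.input (y x) k :=
  (c.measurable_law k).comp (measurable_pi_lambda _ fun i => hy i)

theorem measurable_estimate {α : Type*} [MeasurableSpace α] (c : ControlLaw Nu Ny)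
    {y : α → ℕ → Fin Ny → ℝ} (hy : ∀ j, Measurable fun x => y x j) (k : ℕ) :
    Measurable fun x => s.estimate P c (y x) k := by
  induction k with
  | zero => exact measurable_const
  | succ k ih =>
    exact ((measurable_mulVec _ ih).add (measurable_mulVec _ ((hy k).sub
      (measurable_mulVec _ ih)))).add (measurable_mulVec _ (measurable_input c hy k))

/-- The innovation is a measurable function of the measurements received so far. -/
theorem exists_measurable_innovation (c : ControlLaw Nu Ny) (k : ℕ) :
    ∃ φ : (Fin (k + 1) → Fin Ny → ℝ) → Fin Ny → ℝ, Measurable φ ∧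
      ∀ y : ℕ → Fin Ny → ℝ, s.innovation P c y k = φ fun i => y i := by
  have hm : ∀ j, Measurable fun p : Fin (k + 1) → Fin Ny → ℝ =>
      (if h : j < k + 1 then p ⟨j, h⟩ else 0 : Fin Ny → ℝ) := by
    intro j
    by_cases h : j < k + 1
    · simpa only [h, dite_true] using measurable_pi_apply _
    · simpa only [h, dite_false] using measurable_const
  -- The finite record is extended by zero; by causality these values do not affect the innovation
  -- at time `k`.
  refine ⟨fun p => s.innovation P c (fun j => if h : j < k + 1 then p ⟨j, h⟩ else 0) k,
    (hm k).sub (measurable_mulVec _ (s.measurable_estimate P c hm k)), fun y => ?_⟩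
  simp only [innovation]
  rw [s.estimate_congr P c (y' := fun j => if h : j < k + 1 then y j else 0)]
  · simp
  · intro j hj
    simp [hj.trans (Nat.lt_succ_self k)]

/-- Only the forcing before `k` is required to be measurable, because the σ-algebra will be one `ℐ
k` of the attacker, which need not contain later inputs. -/
theorem measurable_errorResponse {α : Type*} [MeasurableSpace α] {d : α → ℕ → Fin Nx → ℝ} (k : ℕ)
    (hd : ∀ j < k, Measurable fun x => d x j) :
    Measurable fun x => s.errorResponse P 0 (d x) k := by
  induction k with
  | zero => exact measurable_const
  | succ k ih =>
    exact (measurable_mulVec _ (ih fun j hj => hd j (hj.trans (Nat.lt_succ_self k)))).add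
      (hd k (Nat.lt_succ_self k))

theorem measurable_state {α : Type*} [MeasurableSpace α] {x₀ : α → Fin Nx → ℝ}
    {w : α → ℕ → Fin Nx → ℝ} {u : α → ℕ → Fin Nu → ℝ} (hx : Measurable x₀)
    (hw : ∀ j, Measurable fun x => w x j) (hu : ∀ j, Measurable fun x => u x j) (k : ℕ) :
    Measurable fun x => s.state (x₀ x) (w x) (u x) k := by
  induction k with
  | zero => exact hx
  | succ k ih => exact ((measurable_mulVec _ ih).add (measurable_mulVec _ (hu k))).add (hw k)

theorem measurable_nominalLoop {α : Type*} [MeasurableSpace α] (c : ControlLaw Nu Ny)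
    {x₀ : α → Fin Nx → ℝ} {w : α → ℕ → Fin Nx → ℝ} {v : α → ℕ → Fin Ny → ℝ} (hx : Measurable x₀)
    (hw : ∀ j, Measurable fun x => w x j) (hv : ∀ j, Measurable fun x => v x j) (k : ℕ) :
    Measurable fun x => s.nominalLoop c (x₀ x) (w x) (v x) k := by
  induction k with
  | zero => exact hx.prodMk (measurable_pi_lambda _ fun _ => (measurable_mulVec _ hx).add (hv 0))
  | succ k ih =>
    have h1 : Measurable fun x => s.A *ᵥ (s.nominalLoop c (x₀ x) (w x) (v x) k).1 +
        s.B *ᵥ c.law k (s.nominalLoop c (x₀ x) (w x) (v x) k).2 + w x k :=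
      ((measurable_mulVec _ ih.fst).add
        (measurable_mulVec _ ((c.measurable_law k).comp ih.snd))).add (hw k)
    refine h1.prodMk (measurable_pi_lambda _ fun i => ?_)
    refine Fin.lastCases ?_ (fun j => ?_) i
    · simp only [Fin.snoc_last]
      exact (measurable_mulVec _ h1).add (hv (k + 1))
    · simp only [Fin.snoc_castSucc]
      exact (measurable_pi_apply j).comp ih.snd

/-! ### Consequences of the Riccati equation. -/

theorem IsRiccatiSolution.posDef_innovCov {s : Plant Nx Nu Ny} {P : Matrix (Fin Nx) (Fin Nx) ℝ}
    (hP : s.IsRiccatiSolution P) : (s.innovCov P).PosDef := by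
  have h := hP.posSemidef.mul_mul_conjTranspose_same s.C
  rw [conjTranspose_eq_transpose_of_trivial] at h
  exact PosDef.posSemidef_add h s.Sv_posDef

/-- The Riccati equation in Joseph form. -/
theorem IsRiccatiSolution.joseph {s : Plant Nx Nu Ny} {P : Matrix (Fin Nx) (Fin Nx) ℝ}
    (hP : s.IsRiccatiSolution P) :
    (s.A - s.kalmanGain P * s.C) * P * (s.A - s.kalmanGain P * s.C)ᵀ +
      (s.kalmanGain P * s.Sv * (s.kalmanGain P)ᵀ + s.Sw) = P := by
  have hgain : s.kalmanGain P * s.innovCov P = s.A * P * s.Cᵀ := by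
    rw [Plant.kalmanGain, nonsing_inv_mul_cancel_right _ _ hP.posDef_innovCov.det_pos.ne'.isUnit]
  -- The terms ending in `Kᵀ` collect to `(K Σ_z - A P Cᵀ) Kᵀ`, which vanishes by the choice of
  -- gain.
  calc _ = s.A * P * s.Aᵀ - s.kalmanGain P * s.C * P * s.Aᵀ
        + (s.kalmanGain P * s.innovCov P - s.A * P * s.Cᵀ) * (s.kalmanGain P)ᵀ + s.Sw := by
        simp only [innovCov, transpose_sub, transpose_mul, Matrix.sub_mul, Matrix.mul_sub,
          Matrix.mul_add, Matrix.add_mul, Matrix.mul_assoc]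
        abel
    _ = P := by
        conv_rhs => rw [hP.eq]
        rw [hgain, sub_self, Matrix.zero_mul, add_zero, Plant.kalmanGain]

end Plant

/-! ### Second moments of the nominal filtering error -/

section Stochastic

variable {Ω : Type*} {mΩ : MeasurableSpace Ω} {μ : Measure Ω} {Nx Nu Ny : ℕ}
  {s : Plant Nx Nu Ny} {P : Matrix (Fin Nx) (Fin Nx) ℝ} {ξ : Noise Ω Nx Ny}

namespace Noise

/-- The estimation error of the nominal closed loop: the response of the error to the noise. -/
noncomputable def nominalError (s : Plant Nx Nu Ny) (P : Matrix (Fin Nx) (Fin Nx) ℝ)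
    (ξ : Noise Ω Nx Ny) (k : ℕ) (ω : Ω) : Fin Nx → ℝ :=
  s.errorResponse P (-ξ.x₀ ω) (fun j => s.kalmanGain P *ᵥ ξ.v j ω - ξ.w j ω) k

theorem nominalError_succ (k : ℕ) :
    ξ.nominalError s P (k + 1) = fun ω =>
      (s.A - s.kalmanGain P * s.C) *ᵥ ξ.nominalError s P k ω +
        (s.kalmanGain P *ᵥ ξ.v k ω + -ξ.w k ω) := by
  funext ω
  simp [nominalError, Plant.errorResponse, sub_eq_add_neg]

namespace IsGaussian

variable (h : ξ.IsGaussian s P μ)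
include h

theorem memLp_x₀ : MemLp ξ.x₀ 2 μ := memLp_of_hasLaw_multivariateGaussian h.law_x₀

theorem memLp_w (k : ℕ) : MemLp (ξ.w k) 2 μ := memLp_of_hasLaw_multivariateGaussian (h.law_w k)

theorem memLp_v (k : ℕ) : MemLp (ξ.v k) 2 μ := memLp_of_hasLaw_multivariateGaussian (h.law_v k)

theorem memLp_nominalError (k : ℕ) : MemLp (ξ.nominalError s P k) 2 μ := by
  induction k with
  | zero => exact h.memLp_x₀.neg
  | succ k ih =>
    rw [nominalError_succ]
    exact (memLp_mulVec _ ih).add ((memLp_mulVec _ (h.memLp_v k)).add (h.memLp_w k).neg)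

theorem crossMoment_v_eq_zero {b : ℕ} {k : ℕ} {g : Ω → Fin b → ℝ} (hg : MemLp g 2 μ)
    (hi : IndepFun (ξ.v k) g μ) : crossMoment μ (ξ.v k) g = 0 :=
  crossMoment_eq_zero_of_indepFun (h.memLp_v k).1 hg.1 hi
    (integral_eq_zero_of_hasLaw_multivariateGaussian (h.law_v k))

theorem crossMoment_w_eq_zero {b : ℕ} {k : ℕ} {g : Ω → Fin b → ℝ} (hg : MemLp g 2 μ)
    (hi : IndepFun (ξ.w k) g μ) : crossMoment μ (ξ.w k) g = 0 :=
  crossMoment_eq_zero_of_indepFun (h.memLp_w k).1 hg.1 hi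
    (integral_eq_zero_of_hasLaw_multivariateGaussian (h.law_w k))

theorem indepFun_w_v (j k : ℕ) : IndepFun (ξ.w j) (ξ.v k) μ :=
  h.indep_w_v.comp (measurable_pi_apply j) (measurable_pi_apply k)

/-- A vector that is uncorrelated with the initial state and the past noise is uncorrelated with the
nominal error. -/
theorem crossMoment_nominalError_eq_zero {b : ℕ} {f : Ω → Fin b → ℝ} (hf : MemLp f 2 μ) (k : ℕ)
    (hx : crossMoment μ f ξ.x₀ = 0) (hw : ∀ j < k, crossMoment μ f (ξ.w j) = 0)
    (hv : ∀ j < k, crossMoment μ f (ξ.v j) = 0) :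
    crossMoment μ f (ξ.nominalError s P k) = 0 := by
  induction k with
  | zero =>
    have h0 : ξ.nominalError s P 0 = fun ω => -ξ.x₀ ω := rfl
    rw [h0, crossMoment_neg_right, hx, neg_zero]
  | succ k ih =>
    have hK := memLp_mulVec (s.kalmanGain P) (h.memLp_v k)
    have hw' : MemLp (fun ω => -ξ.w k ω) 2 μ := (h.memLp_w k).neg
    have hd : MemLp (fun ω => s.kalmanGain P *ᵥ ξ.v k ω + -ξ.w k ω) 2 μ := hK.add hw'
    rw [nominalError_succ, crossMoment_add_right hf (memLp_mulVec _ (h.memLp_nominalError k)) hd,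
      crossMoment_add_right hf hK hw',
      crossMoment_mulVec_right _ hf (h.memLp_nominalError k),
      crossMoment_mulVec_right _ hf (h.memLp_v k), crossMoment_neg_right,
      hw k (Nat.lt_succ_self k), hv k (Nat.lt_succ_self k),
      ih (fun j hj => hw j (hj.trans (Nat.lt_succ_self k)))
        (fun j hj => hv j (hj.trans (Nat.lt_succ_self k)))]
    simp

/-- The nominal error at time `k` is linear in `x₀` and in noise strictly before `k`, so pairwise
independence of `v k` from each of these suffices. -/
theorem crossMoment_v_nominalError (k : ℕ) :
    crossMoment μ (ξ.v k) (ξ.nominalError s P k) = 0 :=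
  h.crossMoment_nominalError_eq_zero (h.memLp_v k) k
    (h.crossMoment_v_eq_zero h.memLp_x₀
      (h.indep_x₀.symm.comp ((measurable_pi_apply k).comp measurable_snd) measurable_id))
    (fun j _ => h.crossMoment_v_eq_zero (h.memLp_w j) (h.indepFun_w_v j k).symm)
    (fun j hj => h.crossMoment_v_eq_zero (h.memLp_v j) (h.indep_v.indepFun hj.ne'))

theorem crossMoment_w_nominalError (k : ℕ) :
    crossMoment μ (ξ.w k) (ξ.nominalError s P k) = 0 :=
  h.crossMoment_nominalError_eq_zero (h.memLp_w k) k
    (h.crossMoment_w_eq_zero h.memLp_x₀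
      (h.indep_x₀.symm.comp ((measurable_pi_apply k).comp measurable_fst) measurable_id))
    (fun j hj => h.crossMoment_w_eq_zero (h.memLp_w j) (h.indep_w.indepFun hj.ne'))
    (fun j _ => h.crossMoment_w_eq_zero (h.memLp_v j) (h.indepFun_w_v k j))

/-- `P` is the stationary covariance of the nominal estimation error. -/
theorem crossMoment_nominalError_self (hP : s.IsRiccatiSolution P) (k : ℕ) :
    crossMoment μ (ξ.nominalError s P k) (ξ.nominalError s P k) = P := by
  induction k with
  | zero =>
    have h0 : ξ.nominalError s P 0 = fun ω => -ξ.x₀ ω := rfl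
    rw [h0, crossMoment_neg_right, crossMoment_neg_left, neg_neg,
      crossMoment_of_hasLaw_multivariateGaussian hP.posSemidef h.law_x₀]
  | succ k ih =>
    have hN := h.memLp_nominalError k
    have hK := memLp_mulVec (s.kalmanGain P) (h.memLp_v k)
    have hw' : MemLp (fun ω => -ξ.w k ω) 2 μ := (h.memLp_w k).neg
    have hd : MemLp (fun ω => s.kalmanGain P *ᵥ ξ.v k ω + -ξ.w k ω) 2 μ := hK.add hw'
    have hvN : crossMoment μ (ξ.nominalError s P k) (ξ.v k) = 0 := by
      rw [← crossMoment_transpose, h.crossMoment_v_nominalError k, transpose_zero]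
    have hwN : crossMoment μ (ξ.nominalError s P k) (ξ.w k) = 0 := by
      rw [← crossMoment_transpose, h.crossMoment_w_nominalError k, transpose_zero]
    have hvw : crossMoment μ (ξ.v k) (ξ.w k) = 0 :=
      h.crossMoment_v_eq_zero (h.memLp_w k) (h.indepFun_w_v k k).symm
    -- The propagated error, `K v k` and `w k` are pairwise uncorrelated, so their second moments
    -- add up to the Joseph form.
    rw [nominalError_succ, crossMoment_add_self (memLp_mulVec _ hN) hd,
      crossMoment_add_self hK hw', crossMoment_mulVec_self _ hN, ih,
      crossMoment_mulVec_self _ (h.memLp_v k), crossMoment_neg_right, crossMoment_neg_left, neg_neg,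
      crossMoment_of_hasLaw_multivariateGaussian s.Sv_posDef.posSemidef (h.law_v k),
      crossMoment_of_hasLaw_multivariateGaussian s.Sw_posDef.posSemidef (h.law_w k), hP.joseph]
    · rw [crossMoment_neg_right, crossMoment_mulVec_left _ (h.memLp_v k) (h.memLp_w k), hvw]
      simp
    · rw [crossMoment_mulVec_left _ hN hd, crossMoment_add_right hN hK hw',
        crossMoment_mulVec_right _ hN (h.memLp_v k), crossMoment_neg_right, hvN, hwN]
      simp

end IsGaussian

end Noise

/-! ### The error under attack -/

theorem estError_eq (c : ControlLaw Nu Ny) (u : ℕ → Ω → Fin Nu → ℝ) (k : ℕ) (ω : Ω) :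
    estError s P c ξ u k ω =
      s.errorResponse P 0 (fun j => s.B *ᵥ (requestedInput s c ξ u j ω - u j ω)) k +
        ξ.nominalError s P k ω :=
  s.estimate_sub_state P c (ξ.x₀ ω) (fun j => ξ.w j ω) (fun j => ξ.v j ω) (fun j => u j ω) k

/-- Requested and applied inputs agree in the nominal loop, so the control law drops out of the
error. -/
theorem estError_nominalProc (c : ControlLaw Nu Ny) (k : ℕ) :
    estError s P c ξ (nominalProc s c ξ) k = ξ.nominalError s P k := by
  funext ω
  have h (j : ℕ) : requestedInput s c ξ (nominalProc s c ξ) j ω = nominalProc s c ξ j ω :=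
    congrFun (s.input_output_nominalInput c (ξ.x₀ ω) (fun j => ξ.w j ω) (fun j => ξ.v j ω)) j
  simp [estError_eq, h]

/-- The innovation of the controller's filter while `u` is applied to the plant. -/
noncomputable def innovationProc (s : Plant Nx Nu Ny) (P : Matrix (Fin Nx) (Fin Nx) ℝ)
    (c : ControlLaw Nu Ny) (ξ : Noise Ω Nx Ny) (u : ℕ → Ω → Fin Nu → ℝ) (k : ℕ) (ω : Ω) :
    Fin Ny → ℝ :=
  s.innovation P c (fun j => outputProc s ξ u j ω) k

theorem innovationProc_eq (c : ControlLaw Nu Ny) (u : ℕ → Ω → Fin Nu → ℝ) (k : ℕ) (ω : Ω) :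
    innovationProc s P c ξ u k ω = ξ.v k ω + -(s.C *ᵥ estError s P c ξ u k ω) := by
  simp only [innovationProc, Plant.innovation, estError, outputProc, Plant.output, mulVec_sub]
  abel

theorem measurable_outputProc (hξ : ξ.IsGaussian s P μ) {u : ℕ → Ω → Fin Nu → ℝ}
    (hu : ∀ k, Measurable (u k)) (k : ℕ) : Measurable (outputProc s ξ u k) :=
  (Plant.measurable_mulVec _ (s.measurable_state hξ.measurable_x₀ hξ.measurable_w hu k)).add
    (hξ.measurable_v k)

theorem measurable_nominalProc (hξ : ξ.IsGaussian s P μ) (c : ControlLaw Nu Ny) (k : ℕ) :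
    Measurable (nominalProc s c ξ k) :=
  (c.measurable_law k).comp
    (s.measurable_nominalLoop c hξ.measurable_x₀ hξ.measurable_w hξ.measurable_v k).snd

/-- Under a strictly stealthy attack the received measurements have their nominal law. -/
theorem StrictlyStealthy.identDistrib [IsProbabilityMeasure μ] {c : ControlLaw Nu Ny}
    {u : ℕ → Ω → Fin Nu → ℝ} (hs : StrictlyStealthy s c ξ μ u) (hξ : ξ.IsGaussian s P μ)
    (hu : ∀ k, Measurable (u k)) {k : ℕ} (hk : 0 < k) :
    IdentDistrib (fun ω (i : Fin k) => outputProc s ξ u i ω)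
      (fun ω (i : Fin k) => outputProc s ξ (nominalProc s c ξ) i ω) μ μ := by
  classical
  have hm : Measurable fun ω (i : Fin k) => outputProc s ξ u i ω :=
    measurable_pi_lambda _ fun i => measurable_outputProc hξ hu i
  have hm' : Measurable fun ω (i : Fin k) => outputProc s ξ (nominalProc s c ξ) i ω :=
    measurable_pi_lambda _ fun i => measurable_outputProc hξ (measurable_nominalProc hξ c) i
  have : IsProbabilityMeasure (μ.map fun ω (i : Fin k) => outputProc s ξ u i ω) :=
    Measure.isProbabilityMeasure_map hm.aemeasurable
  have : IsProbabilityMeasure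
      (μ.map fun ω (i : Fin k) => outputProc s ξ (nominalProc s c ξ) i ω) :=
    Measure.isProbabilityMeasure_map hm'.aemeasurable
  -- One inequality is enough: applied to complements, it gives the reverse one.
  refine ⟨hm.aemeasurable, hm'.aemeasurable, Measure.eq_of_le_of_isProbabilityMeasure ?_⟩
  refine Measure.le_iff.2 fun S hS => ?_
  -- A detector must act at every horizon: this one tests membership in `S` at time `k` and never
  -- raises an alarm at other times.
  let T (n : ℕ) : Set (Fin n → Fin Ny → ℝ) := if h : k = n then h ▸ S else ∅
  have hTk : T k = S := by simp [T]
  have hT (n : ℕ) : MeasurableSet (T n) := by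
    by_cases h : k = n
    · subst h
      rwa [hTk]
    · simp [T, h]
  let D : Detector Ny :=
    { test := fun n => (T n).indicator 1
      measurable_test := fun n => measurable_one.indicator (hT n)
      test_mem := fun n y => by
        by_cases h : y ∈ T n <;> simp [h] }
  have key := not_lt.1 fun hlt => hs ⟨D, k, hk, hlt⟩
  have hD (y : ℕ → Ω → Fin Ny → ℝ) (hy : Measurable fun ω (i : Fin k) => y i ω) :
      D.alarmProb μ y k = (μ.map fun ω (i : Fin k) => y i ω).real S := by
    have : D.alarmProb μ y k =
        ∫ ω, ((fun ω (i : Fin k) => y i ω) ⁻¹' S).indicator 1 ω ∂μ := by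
      simp only [Detector.alarmProb, D, hTk]
      rfl
    rw [this, integral_indicator_one (hy hS), map_measureReal_apply hy hS]
  rw [hD _ hm, hD _ hm'] at key
  exact (ENNReal.toReal_le_toReal (measure_ne_top _ _) (measure_ne_top _ _)).1 key

/-- The unaware controller runs the same filter in both loops, so a single map `φ` produces both
innovations from the first `k + 1` measurements. -/
theorem StrictlyStealthy.identDistrib_innovation [IsProbabilityMeasure μ] {c : ControlLaw Nu Ny}
    {u : ℕ → Ω → Fin Nu → ℝ} (hs : StrictlyStealthy s c ξ μ u) (hξ : ξ.IsGaussian s P μ)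
    (hu : ∀ k, Measurable (u k)) (k : ℕ) :
    IdentDistrib (innovationProc s P c ξ u k) (innovationProc s P c ξ (nominalProc s c ξ) k) μ μ := by
  obtain ⟨φ, hφ, h⟩ := s.exists_measurable_innovation P c k
  have h' (u : ℕ → Ω → Fin Nu → ℝ) : innovationProc s P c ξ u k =
      φ ∘ fun ω (i : Fin (k + 1)) => outputProc s ξ u i ω := funext fun ω => h _
  rw [h', h']
  exact (hs.identDistrib hξ hu k.succ_pos).comp hφ

/-- The part of the error that is caused by the attack is independent of the current measurement
noise. -/
theorem IsAttack.indepFun_errorResponse [IsProbabilityMeasure μ] {c : ControlLaw Nu Ny}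
    {ℐ : Filtration ℕ mΩ} {u : ℕ → Ω → Fin Nu → ℝ} (ha : IsAttack s c ξ μ ℐ u) (k : ℕ) :
    IndepFun (ξ.v k) (fun ω =>
      s.errorResponse P 0 (fun j => s.B *ᵥ (requestedInput s c ξ u j ω - u j ω)) k) μ := by
  cases k with
  -- At time `0` the response is its zero initial value.
  | zero => exact indepFun_const_right _ _
  | succ k =>
    -- The response at time `k + 1` uses inputs up to time `k` only, and `ℐ k` is independent of the
    -- measurement noise from exactly `k + 1` on.
    have hm : Measurable[ℐ k] fun ω =>
        s.errorResponse P 0 (fun j => s.B *ᵥ (requestedInput s c ξ u j ω - u j ω)) (k + 1) :=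
      @Plant.measurable_errorResponse _ _ _ s P Ω (ℐ k) _ (k + 1) fun j hj =>
        have hjk := ℐ.mono (Nat.lt_succ_iff.1 hj)
        @Plant.measurable_mulVec Ω (ℐ k) _ _ _ _
          (((ha.knows_input j).mono hjk le_rfl).sub ((ha.measurable_attack j).mono hjk le_rfl))
    have hv : MeasurableSpace.comap (ξ.v (k + 1)) inferInstance ≤
        MeasurableSpace.comap (fun ω (j : ℕ) => ξ.v (k + 1 + j) ω) inferInstance := by
      refine Measurable.comap_le ?_
      exact (measurable_pi_apply (X := fun _ : ℕ => Fin Ny → ℝ) 0).comp (comap_measurable _)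
    rw [IndepFun_iff_Indep]
    exact (indep_of_indep_of_le_left (indep_of_indep_of_le_right (ha.indep_v k) hv)
      hm.comap_le).symm

/-- The output error under a strictly stealthy attack is square integrable and has the nominal
covariance `C P Cᵀ`. -/
theorem StrictlyStealthy.outputError [IsProbabilityMeasure μ] {c : ControlLaw Nu Ny}
    {ℐ : Filtration ℕ mΩ} {u : ℕ → Ω → Fin Nu → ℝ} (hs : StrictlyStealthy s c ξ μ u)
    (hP : s.IsRiccatiSolution P) (hξ : ξ.IsGaussian s P μ) (ha : IsAttack s c ξ μ ℐ u) (k : ℕ) :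
    MemLp (fun ω => s.C *ᵥ estError s P c ξ u k ω) 2 μ ∧
      crossMoment μ (fun ω => s.C *ᵥ estError s P c ξ u k ω)
        (fun ω => s.C *ᵥ estError s P c ξ u k ω) = s.C * P * s.Cᵀ := by
  have hid := hs.identDistrib_innovation hξ
    (fun j => (ha.measurable_attack j).mono (ℐ.le j) le_rfl) k
  have hv := hξ.memLp_v k
  have hN := hξ.memLp_nominalError k
  have hCN := memLp_mulVec s.C hN
  have hvCN : crossMoment μ (ξ.v k) (fun ω => s.C *ᵥ ξ.nominalError s P k ω) = 0 := by
    rw [crossMoment_mulVec_right _ hv hN, hξ.crossMoment_v_nominalError, Matrix.zero_mul]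
  have hnom : innovationProc s P c ξ (nominalProc s c ξ) k =
      fun ω => ξ.v k ω + -(s.C *ᵥ ξ.nominalError s P k ω) :=
    funext fun ω => by rw [innovationProc_eq, estError_nominalProc]
  -- Square integrability passes from the nominal innovation through equality of laws.
  have hz : MemLp (innovationProc s P c ξ u k) 2 μ :=
    hid.memLp_iff.2 (hnom ▸ hv.add hCN.neg)
  have hCe : MemLp (fun ω => s.C *ᵥ estError s P c ξ u k ω) 2 μ := by
    have : (fun ω => s.C *ᵥ estError s P c ξ u k ω) = ξ.v k - innovationProc s P c ξ u k :=
      funext fun ω => by simp [innovationProc_eq]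
    rw [this]
    exact hv.sub hz
  refine ⟨hCe, ?_⟩
  set L : Ω → Fin Nx → ℝ := fun ω =>
    s.errorResponse P 0 (fun j => s.B *ᵥ (requestedInput s c ξ u j ω - u j ω)) k
  have hsplit : (fun ω => s.C *ᵥ estError s P c ξ u k ω) =
      fun ω => s.C *ᵥ L ω + s.C *ᵥ ξ.nominalError s P k ω :=
    funext fun ω => by rw [estError_eq, mulVec_add]
  have hCL : MemLp (fun ω => s.C *ᵥ L ω) 2 μ := by
    have : (fun ω => s.C *ᵥ L ω) = (fun ω => s.C *ᵥ estError s P c ξ u k ω) -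
        fun ω => s.C *ᵥ ξ.nominalError s P k ω := by
      rw [hsplit]
      funext ω
      simp
    rw [this]
    exact hCe.sub hCN
  -- Each summand of `C e` is treated separately: zero correlation is additive, so independence of
  -- `v k` from the pair is not needed.
  have hvCL : crossMoment μ (ξ.v k) (fun ω => s.C *ᵥ L ω) = 0 :=
    hξ.crossMoment_v_eq_zero hCL ((ha.indepFun_errorResponse (P := P) k).comp measurable_id
      (Plant.measurable_mulVec s.C measurable_id))
  have hvCe : crossMoment μ (ξ.v k) (fun ω => s.C *ᵥ estError s P c ξ u k ω) = 0 := by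
    rw [hsplit, crossMoment_add_right hv hCL hCN, hvCL, hvCN, add_zero]
  have hatt : innovationProc s P c ξ u k =
      fun ω => ξ.v k ω + -(s.C *ᵥ estError s P c ξ u k ω) :=
    funext fun ω => innovationProc_eq c u k ω
  have hmom := crossMoment_congr_identDistrib hid
  have hCe' : MemLp (fun ω => -(s.C *ᵥ estError s P c ξ u k ω)) 2 μ := hCe.neg
  have hCN' : MemLp (fun ω => -(s.C *ᵥ ξ.nominalError s P k ω)) 2 μ := hCN.neg
  rw [hnom, hatt, crossMoment_add_self hv hCe' (by rw [crossMoment_neg_right, hvCe, neg_zero]),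
    crossMoment_add_self hv hCN' (by rw [crossMoment_neg_right, hvCN, neg_zero])] at hmom
  -- The common term `E[v vᵀ]` cancels without being evaluated.
  have hmom' := add_left_cancel hmom
  simp only [crossMoment_neg_right, crossMoment_neg_left, neg_neg] at hmom'
  rw [hmom', crossMoment_mulVec_self _ hN, hξ.crossMoment_nominalError_self hP]

theorem StrictlyStealthy.weightedMSE_estError [IsProbabilityMeasure μ] {c : ControlLaw Nu Ny}
    {ℐ : Filtration ℕ mΩ} {u : ℕ → Ω → Fin Nu → ℝ} (hs : StrictlyStealthy s c ξ μ u)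
    (hP : s.IsRiccatiSolution P) (hξ : ξ.IsGaussian s P μ) (ha : IsAttack s c ξ μ ℐ u) (k : ℕ) :
    weightedMSE μ (s.weight P) (estError s P c ξ u k)
      = ENNReal.ofReal (P * s.weight P).trace := by
  obtain ⟨hm, hc⟩ := hs.outputError hP hξ ha k
  rw [Plant.weight, weightedMSE_mulVec, weightedMSE_eq hP.posDef_innovCov.inv.posSemidef hm, hc]
  congr 1
  calc (s.C * P * s.Cᵀ * (s.innovCov P)⁻¹).trace
      = (s.C * (P * s.Cᵀ * (s.innovCov P)⁻¹)).trace := by simp only [Matrix.mul_assoc]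
    _ = (P * s.Cᵀ * (s.innovCov P)⁻¹ * s.C).trace := trace_mul_comm _ _
    _ = (P * (s.Cᵀ * (s.innovCov P)⁻¹ * s.C)).trace := by simp only [Matrix.mul_assoc]

end Stochastic

/-! ### The weight and time averages of constants. -/

theorem Plant.IsRiccatiSolution.posSemidef_weight {Nx Nu Ny : ℕ} {s : Plant Nx Nu Ny}
    {P : Matrix (Fin Nx) (Fin Nx) ℝ} (hP : s.IsRiccatiSolution P) : (s.weight P).PosSemidef := by
  have h := hP.posDef_innovCov.inv.posSemidef.conjTranspose_mul_mul_same s.C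
  rwa [conjTranspose_eq_transpose_of_trivial] at h

theorem avgWeightedMSE_of_const {Ω : Type*} {mΩ : MeasurableSpace Ω} {μ : Measure Ω} {Nx : ℕ}
    {W : Matrix (Fin Nx) (Fin Nx) ℝ} {e : ℕ → Ω → Fin Nx → ℝ} {t : ℝ≥0∞}
    (h : ∀ k, weightedMSE μ W (e k) = t) : avgWeightedMSE μ W e = t := by
  have : (fun k : ℕ => (∑ n ∈ Finset.range k, weightedMSE μ W (e n)) / (k : ℝ≥0∞))
      =ᶠ[atTop] fun _ => t := by
    -- At `k = 0` the average is `0 / 0`, so it is constant only from `k = 1` on.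
    filter_upwards [eventually_gt_atTop 0] with k hk
    simp only [h, Finset.sum_const, Finset.card_range, nsmul_eq_mul]
    rw [mul_comm]
    exact ENNReal.mul_div_cancel_right (by exact_mod_cast hk.ne') (ENNReal.natCast_ne_top k)
  rw [avgWeightedMSE, limsup_congr this, limsup_const]

theorem avgTraceCov_of_const {Ω : Type*} {mΩ : MeasurableSpace Ω} {μ : Measure Ω} {Nx : ℕ}
    {W : Matrix (Fin Nx) (Fin Nx) ℝ} {e : ℕ → Ω → Fin Nx → ℝ} {t : ℝ}
    (h : ∀ k, (errorCov μ (e k) * W).trace = t) : avgTraceCov μ W e = t := by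
  have : (fun k : ℕ =>
      (((∑ n ∈ Finset.range k, (errorCov μ (e n) * W).trace) / (k : ℝ) : ℝ) : EReal))
      =ᶠ[atTop] fun _ => (t : EReal) := by
    filter_upwards [eventually_gt_atTop 0] with k hk
    have hk' : (k : ℝ) ≠ 0 := by exact_mod_cast hk.ne'
    simp only [h, Finset.sum_const, Finset.card_range, nsmul_eq_mul]
    rw [mul_div_cancel_left₀ _ hk']
  rw [avgTraceCov, limsup_congr this, limsup_const]

end StealthyAttack

open StealthyAttack in
theorem corollary1 {Nx Nu Ny : ℕ} (s : Plant Nx Nu Ny)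
    (P : Matrix (Fin Nx) (Fin Nx) ℝ) (hP : s.IsRiccatiSolution P)
    (c : ControlLaw Nu Ny)
    {Ω : Type*} [mΩ : MeasurableSpace Ω] (μ : Measure Ω) [IsProbabilityMeasure μ]
    (ξ : Noise Ω Nx Ny) (hξ : ξ.IsGaussian s P μ)
    (ℐ : Filtration ℕ mΩ) (u : ℕ → Ω → Fin Nu → ℝ) (hu : IsAttack s c ξ μ ℐ u)
    (hstealthy : StrictlyStealthy s c ξ μ u) :
    -- the limsup of the averaged weighted errors under attack is at most `tr(P W)`
    avgWeightedMSE μ (s.weight P) (estError s P c ξ u)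
        ≤ ENNReal.ofReal (P * s.weight P).trace ∧
    -- the same in terms of the error covariance matrices, whenever these exist
    ((∀ k, MemLp (estError s P c ξ u k) 2 μ) →
      avgTraceCov μ (s.weight P) (estError s P c ξ u) ≤ ((P * s.weight P).trace : EReal)) ∧
    -- `tr(P W)` is the value without attack, so that the attack causes no degradation
    avgWeightedMSE μ (s.weight P) (estError s P c ξ (nominalProc s c ξ))
        = ENNReal.ofReal (P * s.weight P).trace := by
  have hW := hP.posSemidef_weight
  have hMSE := hstealthy.weightedMSE_estError hP hξ hu
  have trace_nonneg {f : Ω → Fin Nx → ℝ} (hf : MemLp f 2 μ) :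
      0 ≤ (crossMoment μ f f * s.weight P).trace := by
    rw [← integral_quadraticForm _ hf]
    exact integral_nonneg fun ω => by simpa using hW.dotProduct_mulVec_nonneg (f ω)
  refine ⟨(avgWeightedMSE_of_const hMSE).le, fun hL2 => (avgTraceCov_of_const fun k => ?_).le,
    avgWeightedMSE_of_const fun k => ?_⟩
  -- `ENNReal.ofReal` is injective only on nonnegative reals, so both traces need a sign; for `P` it
  -- comes from realizing `P` as the second moment of the nominal error.
  · have h0 : 0 ≤ (P * s.weight P).trace := by
      have := trace_nonneg (hξ.memLp_nominalError 0)
      rwa [hξ.crossMoment_nominalError_self hP 0] at this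
    have h1 := hMSE k
    rw [weightedMSE_eq hW (hL2 k)] at h1
    -- `errorCov μ e` is `crossMoment μ e e` by definition.
    exact (ENNReal.ofReal_eq_ofReal_iff (trace_nonneg (hL2 k)) h0).1 h1
  · rw [estError_nominalProc, weightedMSE_eq hW (hξ.memLp_nominalError k),
      hξ.crossMoment_nominalError_self hP k]
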